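/- Let $P$ be a simple $d$-polytope (a $d$-dimensional convex polytope each of whose vertices lies on exactly $d$ edges) and let $2 \le k \le d-1$. Let $G(P)$ be the graph of $P$, formed by the vertices and the edges of $P$. If $\mathcal{O}$ is an acyclic orientation of $G(P)$ that has more than one global sink (vertex of $G(P)$ with no outgoing edge), then there is a $k$-dimensional face $F$ of $P$ on which $\mathcal{O}$ induces more than one sink, i.e. the subgraph of $G(P)$ induced by the vertices of $F$, with the orientation restricted from $\mathcal{O}$, has at least two sinks. -/

import Mathlib

section Polytopes

variable {E : Type*} [NormedAddCommGroup E] [NormedSpace ℝ E]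

/-- `P` is a (convex) `d`-polytope: the convex hull of finitely many points (at least one),
whose affine hull has dimension `d`. -/
structure IsPolytope (P : Set E) (d : ℕ) : Prop where
  exists_finset : ∃ s : Finset E, P = convexHull ℝ (s : Set E)
  nonempty : P.Nonempty
  dim_eq : Module.finrank ℝ (vectorSpan ℝ P) = d

/-- `F` is a `k`-face of `P`: a non-empty set of the form `{x ∈ P | l x is maximal over P}` for
a linear functional `l`, whose affine hull has dimension `k`. -/
structure IsKFace (P F : Set E) (k : ℕ) : Prop where
  exposed : IsExposed ℝ P F
  nonempty : F.Nonempty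
  dim_eq : Module.finrank ℝ (vectorSpan ℝ F) = k

/-- The vertices of `P`, as a type. -/
abbrev PolytopeVertex (P : Set E) : Type _ := ↥(Set.extremePoints ℝ P)

/-- The graph of `P`: two vertices are adjacent iff they are the end points of an edge
(that is, of a `1`-face) of `P`. -/
def polytopeGraph (P : Set E) : SimpleGraph (PolytopeVertex P) where
  Adj v w := v ≠ w ∧ IsKFace P (segment ℝ (v : E) (w : E)) 1
  symm := ⟨fun v w h => ⟨h.1.symm, by rw [segment_symm]; exact h.2⟩⟩
  loopless := ⟨fun _ h => h.1 rfl⟩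

/-- `P` is a simple `d`-polytope: a `d`-polytope each of whose vertices lies on exactly `d`
edges. -/
structure IsSimplePolytope (P : Set E) (d : ℕ) : Prop where
  isPolytope : IsPolytope P d
  degree_eq : ∀ v : PolytopeVertex P, ((polytopeGraph P).neighborSet v).encard = d

/-- The vertices of `P` that lie in `F`; if `F` is a face of `P`, these are the vertices
of `F`. -/
def faceVertices (P F : Set E) : Set (PolytopeVertex P) := {v | (v : E) ∈ F}

end Polytopes

section Orientations

variable {V : Type*}

/-- The directed graph `O` is an acyclic orientation of the graph `G`: it arises by choosing
exactly one of the two directions for each edge of `G`, and it has no directed cycle. -/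
structure IsAcyclicOrientation (G : SimpleGraph V) (O : Digraph V) : Prop where
  adj_iff : ∀ v w : V, G.Adj v w ↔ (O.Adj v w ∨ O.Adj w v)
  asymm : ∀ v w : V, O.Adj v w → ¬ O.Adj w v
  acyclic : ∀ v : V, ¬ Relation.TransGen O.Adj v v

/-- The sinks that `O` induces on the vertex set `W`: the vertices in `W` without an edge
directed to another vertex in `W`. -/
def inducedSinks (O : Digraph V) (W : Set V) : Set V := {v ∈ W | ∀ w ∈ W, ¬ O.Adj v w}

end Orientations

/-! Contrapositive, by Newman's diamond argument. Suppose every `k`-face has at most one induced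
sink. By `exists_isKFace_of_adj`, two out-neighbours `u`, `w` of a vertex lie in a common `k`-face;
directed paths inside it lead from both to its only sink. So the orientation is locally confluent,
and it terminates, being acyclic on a finite graph. Hence each vertex reaches exactly one global
sink; adjacent vertices reach the same one, and the graph is connected, so there is only one. The
geometric input is `sub_mem_edgeCone`: `P` lies in the cone spanned by the edges at `v`. If `P` is
simple, these `d` edge directions are linearly independent, so a functional can be prescribed on
them to cut out the face spanned by any chosen subset. -/

section PolytopeGeometry

variable {E : Type*} [NormedAddCommGroup E] [NormedSpace ℝ E]

open scoped NNReal

/-! ### Vertices and edges as maximizers of functionals -/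

/-- An extreme point of the convex hull of a finite set is strictly separated from the remaining
points of that set. -/
theorem exists_forall_lt_of_mem_extremePoints_convexHull {T : Set E} (hT : T.Finite) {y : E}
    (hy : y ∈ Set.extremePoints ℝ (convexHull ℝ T)) :
    ∃ m : E →L[ℝ] ℝ, ∀ t ∈ T, t ≠ y → m t < m y := by
  have hnot : y ∉ convexHull ℝ (T \ {y}) := by
    rw [(convex_convexHull ℝ T).mem_extremePoints_iff_mem_sdiff_convexHull_sdiff] at hy
    exact fun h => hy.2 (convexHull_mono (Set.sdiff_subset_sdiff_left (subset_convexHull ℝ T)) h)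
  have hfin : (T \ {y}).Finite := hT.subset Set.sdiff_subset
  obtain ⟨m, a, b, h1, hab, h2⟩ := geometric_hahn_banach_compact_closed (convex_convexHull ℝ (T \ {y}))
    (hfin.isCompact_convexHull (𝕜 := ℝ)) (convex_singleton y) isClosed_singleton
    (Set.disjoint_singleton_right.2 hnot)
  exact ⟨m, fun t ht hne =>
    ((h1 t (subset_convexHull ℝ _ ⟨ht, hne⟩)).trans hab).trans (h2 y rfl)⟩

theorem convexHull_extremePoints_convexHull {T : Set E} (hT : T.Finite) :
    convexHull ℝ (Set.extremePoints ℝ (convexHull ℝ T)) = convexHull ℝ T := by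
  have hfin : (Set.extremePoints ℝ (convexHull ℝ T)).Finite :=
    hT.subset extremePoints_convexHull_subset
  rw [← (hfin.isClosed_convexHull (𝕜 := ℝ)).closure_eq]
  exact closure_convexHull_extremePoints (hT.isCompact_convexHull (𝕜 := ℝ)) (convex_convexHull ℝ T)

namespace IsPolytope

variable {P : Set E} {d : ℕ}

theorem finite_extremePoints (hP : IsPolytope P d) : (Set.extremePoints ℝ P).Finite := by
  obtain ⟨s, rfl⟩ := hP.exists_finset
  exact s.finite_toSet.subset extremePoints_convexHull_subset

theorem convexHull_extremePoints (hP : IsPolytope P d) :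
    convexHull ℝ (Set.extremePoints ℝ P) = P := by
  obtain ⟨s, rfl⟩ := hP.exists_finset
  exact convexHull_extremePoints_convexHull s.finite_toSet

theorem isCompact (hP : IsPolytope P d) : IsCompact P := by
  obtain ⟨s, rfl⟩ := hP.exists_finset
  exact s.finite_toSet.isCompact_convexHull (𝕜 := ℝ)

theorem convex (hP : IsPolytope P d) : Convex ℝ P := by
  obtain ⟨s, rfl⟩ := hP.exists_finset
  exact convex_convexHull ℝ _

/-- Every vertex of a polytope is the unique maximizer of some linear functional among the
vertices. -/
theorem exists_forall_lt (hP : IsPolytope P d) {v : E} (hv : v ∈ Set.extremePoints ℝ P) :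
    ∃ m : E →L[ℝ] ℝ, ∀ w ∈ Set.extremePoints ℝ P, w ≠ v → m w < m v := by
  apply exists_forall_lt_of_mem_extremePoints_convexHull hP.finite_extremePoints
  rwa [hP.convexHull_extremePoints]

end IsPolytope

/-- Of two distinct vertices on one ray from `v`, the nearer would be interior to a segment in `P`.
-/
theorem eq_of_sub_eq_smul_sub {P : Set E} {v u w : E} (hv : v ∈ Set.extremePoints ℝ P)
    (hu : u ∈ Set.extremePoints ℝ P) (hw : w ∈ Set.extremePoints ℝ P) (huv : u ≠ v) {a : ℝ}
    (ha : 0 < a) (h : w - v = a • (u - v)) : w = u := by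
  have key : ∀ {p q : E}, p ∈ Set.extremePoints ℝ P → q ∈ Set.extremePoints ℝ P → q ≠ v →
      ∀ {b : ℝ}, 0 < b → b < 1 → p - v ≠ b • (q - v) := by
    intro p q hp hq hqv b hb hb1 hpq
    have hmem : p ∈ openSegment ℝ v q := by
      refine ⟨1 - b, b, by linarith, hb, by ring, ?_⟩
      rw [sub_eq_iff_eq_add.1 hpq]
      module
    have h1 := (mem_extremePoints.1 hp).2 v hv.1 q hq.1 hmem
    exact hqv (h1.2.trans h1.1.symm)
  have hwv : w ≠ v := by
    rintro rfl
    rw [sub_self, eq_comm, smul_eq_zero, sub_eq_zero] at h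
    exact h.elim ha.ne' huv
  rcases lt_trichotomy a 1 with h1 | h1 | h1
  · exact absurd h (key hw hu huv ha h1)
  · rw [h1, one_smul] at h
    exact sub_left_injective h
  · refine absurd ?_ (key hu hw hwv (inv_pos.2 ha) (inv_lt_one_of_one_lt₀ h1))
    rw [h, inv_smul_smul₀ ha.ne']

theorem finrank_vectorSpan_segment {v u : E} (h : v ≠ u) :
    Module.finrank ℝ (vectorSpan ℝ (segment ℝ v u)) = 1 := by
  rw [← convexHull_pair, ← direction_affineSpan, affineSpan_convexHull, direction_affineSpan,
    vectorSpan_pair_rev]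
  exact finrank_span_singleton (by simpa [sub_eq_zero] using h.symm)

/-- If a linear functional is maximal among the vertices of `P` exactly at `v` and `u`, then `v`
and `u` are adjacent. -/
theorem polytopeGraph_adj_of_isMax {P : Set E} {d : ℕ} (hP : IsPolytope P d)
    {v u : PolytopeVertex P} (hvu : v ≠ u) (m : E →L[ℝ] ℝ) (hmu : m u = m v)
    (hm : ∀ w : PolytopeVertex P, w ≠ v → w ≠ u → m w < m v) : (polytopeGraph P).Adj v u := by
  have hle : ∀ y ∈ P, m y ≤ m v := by
    intro y hy
    rw [← hP.convexHull_extremePoints] at hy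
    have hsub : Set.extremePoints ℝ P ⊆ {y | m y ≤ m v} := by
      intro w hw
      by_cases h1 : (⟨w, hw⟩ : PolytopeVertex P) = v
      · subst h1; exact le_refl (m w)
      by_cases h2 : (⟨w, hw⟩ : PolytopeVertex P) = u
      · subst h2; exact hmu.le
      exact (hm ⟨w, hw⟩ h1 h2).le
    exact convexHull_min hsub (convex_halfSpace_le m.isLinear _) hy
  have hne : (v : E) ≠ u := fun h => hvu (Subtype.ext h)
  have hexp : IsExposed ℝ P {x ∈ P | ∀ y ∈ P, m y ≤ m x} := fun _ => ⟨m, rfl⟩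
  have hvF : (v : E) ∈ {x ∈ P | ∀ y ∈ P, m y ≤ m x} := ⟨v.2.1, hle⟩
  have huF : (u : E) ∈ {x ∈ P | ∀ y ∈ P, m y ≤ m x} :=
    ⟨u.2.1, fun y hy => (hle y hy).trans hmu.ge⟩
  have hconv := hexp.convex hP.convex
  have hseg : segment ℝ (v : E) u = {x ∈ P | ∀ y ∈ P, m y ≤ m x} := by
    apply (hconv.segment_subset hvF huF).antisymm
    -- By Krein–Milman it suffices to find the extreme points of the exposed face. They are vertices
    -- of `P` maximizing `m`, hence `v` or `u`.
    rw [← closure_convexHull_extremePoints (hexp.isCompact hP.isCompact) hconv, ← convexHull_pair,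
      ← ((Set.toFinite {(v : E), (u : E)}).isClosed_convexHull (𝕜 := ℝ)).closure_eq]
    apply closure_mono
    apply convexHull_mono
    intro w hw
    have hwP : w ∈ Set.extremePoints ℝ P := hexp.isExtreme.extremePoints_subset_extremePoints hw
    by_contra hcon
    simp only [Set.mem_insert_iff, Set.mem_singleton_iff, not_or] at hcon
    have := hm ⟨w, hwP⟩ (fun h => hcon.1 (congrArg Subtype.val h))
      (fun h => hcon.2 (congrArg Subtype.val h))
    exact absurd (hw.1.2 v v.2.1) (not_le.2 this)
  refine ⟨hvu, ?_, ⟨v, left_mem_segment ℝ _ _⟩, finrank_vectorSpan_segment hne⟩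
  rw [hseg]
  exact hexp

/-! ### Edge cones and connectedness of the graph -/

/-- The cone spanned by the directions of the edges of `P` at `v`. -/
def edgeCone (P : Set E) (v : PolytopeVertex P) : Submodule ℝ≥0 E :=
  Submodule.span ℝ≥0 ((fun u : PolytopeVertex P => (u - v : E)) '' (polytopeGraph P).neighborSet v)

theorem smul_mem_edgeCone {P : Set E} {v : PolytopeVertex P} {x : E} (hx : x ∈ edgeCone P v)
    {a : ℝ} (ha : 0 ≤ a) : a • x ∈ edgeCone P v :=
  (edgeCone P v).smul_mem (⟨a, ha⟩ : ℝ≥0) hx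

theorem convex_edgeCone (P : Set E) (v : PolytopeVertex P) :
    Convex ℝ (edgeCone P v : Set E) := fun _ hx _ hy _ _ ha hb _ =>
  add_mem (smul_mem_edgeCone hx ha) (smul_mem_edgeCone hy hb)

/-- A polytope is contained in the cone based at any of its vertices that is spanned by the edges
at this vertex. -/
theorem IsPolytope.sub_mem_edgeCone {P : Set E} {d : ℕ} (hP : IsPolytope P d)
    (v : PolytopeVertex P) {x : E} (hx : x ∈ P) : x - v ∈ edgeCone P v := by
  obtain ⟨l, hl⟩ := hP.exists_forall_lt v.2
  -- Vertex figure: each direction `w - v` is rescaled to the hyperplane where `l` equals `-1`. The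
  -- extreme points of the hull of `T` turn out to be edge directions.
  let y : E → E := fun w => (l v - l w)⁻¹ • (w - v)
  let T : Set E := y '' (Set.extremePoints ℝ P \ {(v : E)})
  have hT : T.Finite := (hP.finite_extremePoints.subset Set.sdiff_subset).image y
  have hpos : ∀ {w : E}, w ∈ Set.extremePoints ℝ P → w ≠ v → 0 < l v - l w :=
    fun hw hne => sub_pos.2 (hl _ hw hne)
  have hy : ∀ {w : E}, w ∈ Set.extremePoints ℝ P → w ≠ v → w - v = (l v - l w) • y w :=
    fun hw hne => (smul_inv_smul₀ (hpos hw hne).ne' _).symm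
  have hly : ∀ {w : E}, w ∈ Set.extremePoints ℝ P → w ≠ v → l (y w) = -1 := by
    intro w hw hne
    have := (hpos hw hne).ne'
    simp only [y, map_smul, map_sub, smul_eq_mul]
    field_simp
    ring
  have hext : Set.extremePoints ℝ (convexHull ℝ T) ⊆ edgeCone P v := by
    intro y₀ hy₀
    obtain ⟨m, hm⟩ := exists_forall_lt_of_mem_extremePoints_convexHull hT hy₀
    obtain ⟨u, ⟨hu, huv⟩, rfl⟩ := extremePoints_convexHull_subset hy₀
    rw [Set.mem_singleton_iff] at huv
    -- As `l = -1` on `T`, adding `m (y u) • l` to `m` shifts its maximum over `T` to `0`. The new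
    -- functional is thus maximal among the vertices exactly at `v` and on the ray through `u`.
    have hval : ∀ {w : E}, w ∈ Set.extremePoints ℝ P → w ≠ v →
        (m + m (y u) • l) w - (m + m (y u) • l) v = (l v - l w) * (m (y w) - m (y u)) := by
      intro w hw hne
      rw [← map_sub, hy hw hne]
      simp only [map_smul, add_apply, smul_apply,
        smul_eq_mul, hly hw hne]
      ring
    have hadj : (polytopeGraph P).Adj v ⟨u, hu⟩ := by
      refine polytopeGraph_adj_of_isMax hP (fun h => huv (congrArg Subtype.val h).symm)
        (m + m (y u) • l) ?_ ?_
      · have := hval hu huv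
        rw [sub_self, mul_zero] at this
        exact sub_eq_zero.1 this
      · intro w hwv hwu
        have hwv' : (w : E) ≠ v := fun h => hwv (Subtype.ext h)
        have hyne : y w ≠ y u := by
          intro h
          refine hwu (Subtype.ext (eq_of_sub_eq_smul_sub v.2 hu w.2 huv
            (div_pos (hpos w.2 hwv') (hpos hu huv)) ?_))
          rw [hy w.2 hwv', h, div_eq_mul_inv, mul_smul]
        rw [← sub_neg, hval w.2 hwv']
        exact mul_neg_of_pos_of_neg (hpos w.2 hwv')
          (sub_neg.2 (hm _ ⟨w, ⟨w.2, hwv'⟩, rfl⟩ hyne))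
    exact smul_mem_edgeCone (Submodule.subset_span ⟨⟨u, hu⟩, hadj, rfl⟩)
      (inv_pos.2 (hpos hu huv)).le
  have hsub : T ⊆ edgeCone P v := by
    refine (subset_convexHull ℝ T).trans ?_
    rw [← convexHull_extremePoints_convexHull hT]
    exact convexHull_min hext (convex_edgeCone P v)
  have hvert : Set.extremePoints ℝ P ⊆ (fun z => z - (v : E)) ⁻¹' edgeCone P v := by
    intro w hw
    by_cases hwv : w = v
    · simp [hwv]
    · change w - v ∈ edgeCone P v
      rw [hy hw hwv]
      exact smul_mem_edgeCone (hsub ⟨w, ⟨hw, hwv⟩, rfl⟩) (hpos hw hwv).le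
  rw [← hP.convexHull_extremePoints] at hx
  have hconv : Convex ℝ ((fun z => z - (v : E)) ⁻¹' (edgeCone P v : Set E)) := by
    simpa only [sub_eq_add_neg] using (convex_edgeCone P v).translate_preimage_left (-(v : E))
  exact convexHull_min hvert hconv hx

/-- A vertex that does not maximize `m` over `P` has a neighbour with a larger value. -/
theorem IsPolytope.exists_adj_lt {P : Set E} {d : ℕ} (hP : IsPolytope P d)
    (v : PolytopeVertex P) (m : E →L[ℝ] ℝ) {x : E} (hx : x ∈ P) (h : m v < m x) :
    ∃ u, (polytopeGraph P).Adj v u ∧ m v < m u := by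
  by_contra! hcon
  have key : ∀ z ∈ edgeCone P v, m z ≤ 0 := by
    intro z hz
    induction hz using Submodule.span_induction with
    | mem z hz =>
      obtain ⟨u, hu, rfl⟩ := hz
      simpa using hcon u hu
    | zero => simp
    | add a b _ _ ha hb => rw [map_add]; exact add_nonpos ha hb
    | smul c a _ ha =>
      rw [NNReal.smul_def, map_smul]
      exact mul_nonpos_of_nonneg_of_nonpos c.2 ha
  have := key _ (hP.sub_mem_edgeCone v hx)
  rw [map_sub] at this
  linarith

theorem IsPolytope.preconnected_polytopeGraph {P : Set E} {d : ℕ} (hP : IsPolytope P d) :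
    (polytopeGraph P).Preconnected := by
  intro v w
  obtain ⟨m, hm⟩ := hP.exists_forall_lt w.2
  have : Finite (PolytopeVertex P) := hP.finite_extremePoints
  -- As in the simplex method, `m` increases along edges until its unique maximizer `w` is reached.
  have hwf : WellFounded fun a b : PolytopeVertex P => m b < m a :=
    Finite.wellFounded_of_trans_of_irrefl (fun a b : PolytopeVertex P => m b < m a)
  induction v using hwf.induction with
  | _ v ih =>
    by_cases hvw : v = w
    · rw [hvw]
    · obtain ⟨u, hvu, hlt⟩ := hP.exists_adj_lt v m w.2.1
        (hm v v.2 fun h => hvw (Subtype.ext h))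
      exact hvu.reachable.trans (ih u hlt)

/-! ### Faces spanned by edges at a simple vertex -/

/-- In a simple polytope, any `k` edges at a vertex lie in a common `k`-face. -/
theorem IsSimplePolytope.exists_isKFace [FiniteDimensional ℝ E] {P : Set E} {d : ℕ}
    (hP : IsSimplePolytope P d) (v : PolytopeVertex P)
    (S : Finset ((polytopeGraph P).neighborSet v)) :
    ∃ F : Set E, IsKFace P F S.card ∧ (v : E) ∈ F ∧ ∀ u ∈ S, ((u : PolytopeVertex P) : E) ∈ F := by
  classical
  let b : (polytopeGraph P).neighborSet v → E := fun u => ((u : PolytopeVertex P) : E) - v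
  have : Finite (PolytopeVertex P) := hP.isPolytope.finite_extremePoints
  have : Fintype ((polytopeGraph P).neighborSet v) := Fintype.ofFinite _
  have hrange : (fun u : PolytopeVertex P => (u - v : E)) '' (polytopeGraph P).neighborSet v
      = Set.range b := Set.image_eq_range _ _
  have hspan : vectorSpan ℝ P ≤ Submodule.span ℝ (Set.range b) := by
    rw [vectorSpan_eq_span_vsub_set_right ℝ v.2.1, Submodule.span_le]
    rintro _ ⟨x, hx, rfl⟩
    have h := hP.isPolytope.sub_mem_edgeCone v hx
    rw [edgeCone, hrange] at h
    exact Submodule.span_le_restrictScalars ℝ≥0 ℝ _ h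
  have hcard : Fintype.card ((polytopeGraph P).neighborSet v) = d := by
    have h := hP.degree_eq v
    rw [Set.encard_eq_coe_toFinset_card, Set.toFinset_card] at h
    exact_mod_cast h
  -- The `d` edge directions span at least the `d`-dimensional direction space of `P`.
  have hli : LinearIndependent ℝ b := by
    rw [linearIndependent_iff_card_le_finrank_span, hcard, ← hP.isPolytope.dim_eq]
    exact Submodule.finrank_mono hspan
  obtain ⟨l₀, hl₀⟩ := LinearMap.exists_extend
    ((Module.Basis.span hli).constr ℝ fun u => if u ∈ S then (0 : ℝ) else -1)
  let l : E →L[ℝ] ℝ := LinearMap.toContinuousLinearMap l₀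
  have hlb : ∀ u, l (b u) = if u ∈ S then (0 : ℝ) else -1 := by
    intro u
    have h := LinearMap.congr_fun hl₀ (Module.Basis.span hli u)
    rw [Module.Basis.constr_basis, LinearMap.comp_apply, Submodule.subtype_apply,
      Module.Basis.span_apply] at h
    exact h
  -- Cone coefficients are nonnegative, so no cancellation occurs: `l z = 0` excludes the directions
  -- outside `S`.
  have key : ∀ z ∈ edgeCone P v, l z ≤ 0 ∧ (l z = 0 → z ∈ Submodule.span ℝ (b '' S)) := by
    intro z hz
    rw [edgeCone, hrange] at hz
    induction hz using Submodule.span_induction with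
    | mem z hz =>
      obtain ⟨u, rfl⟩ := hz
      rw [hlb]
      split_ifs with hu
      · exact ⟨le_rfl, fun _ => Submodule.subset_span ⟨u, hu, rfl⟩⟩
      · norm_num
    | zero => simp
    | add x y _ _ hx hy =>
      rw [map_add]
      exact ⟨add_nonpos hx.1 hy.1, fun h =>
        add_mem (hx.2 (by linarith [hx.1, hy.1])) (hy.2 (by linarith [hx.1, hy.1]))⟩
    | smul c x _ hx =>
      rw [NNReal.smul_def, map_smul, smul_eq_mul]
      refine ⟨mul_nonpos_of_nonneg_of_nonpos c.2 hx.1, fun h => ?_⟩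
      rcases mul_eq_zero.1 h with h | h
      · rw [h, zero_smul]
        exact zero_mem _
      · exact Submodule.smul_mem _ _ (hx.2 h)
  have hle : ∀ x ∈ P, l x ≤ l v := fun x hx => by
    have := (key _ (hP.isPolytope.sub_mem_edgeCone v hx)).1
    rwa [map_sub, sub_nonpos] at this
  have hvF : (v : E) ∈ {x ∈ P | ∀ y ∈ P, l y ≤ l x} := ⟨v.2.1, hle⟩
  have huF : ∀ u ∈ S, ((u : PolytopeVertex P) : E) ∈ {x ∈ P | ∀ y ∈ P, l y ≤ l x} := by
    intro u hu
    have h := hlb u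
    rw [if_pos hu, map_sub, sub_eq_zero] at h
    exact ⟨u.1.2.1, fun y hy => (hle y hy).trans h.ge⟩
  have hdim : vectorSpan ℝ {x ∈ P | ∀ y ∈ P, l y ≤ l x} = Submodule.span ℝ (b '' S) := by
    apply le_antisymm
    · rw [vectorSpan_eq_span_vsub_set_right ℝ hvF, Submodule.span_le]
      rintro _ ⟨x, hx, rfl⟩
      refine (key _ (hP.isPolytope.sub_mem_edgeCone v hx.1)).2 ?_
      rw [map_sub, sub_eq_zero]
      exact (hle x hx.1).antisymm (hx.2 v v.2.1)
    · rw [Submodule.span_le]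
      rintro _ ⟨u, hu, rfl⟩
      exact vsub_mem_vectorSpan ℝ (huF u hu) hvF
  refine ⟨_, ⟨fun _ => ⟨l, rfl⟩, ⟨v, hvF⟩, ?_⟩, hvF, huF⟩
  rw [hdim, Set.image_eq_range]
  have hS : LinearIndependent ℝ fun u : (S : Set ((polytopeGraph P).neighborSet v)) => b u :=
    hli.comp _ Subtype.val_injective
  rw [finrank_span_eq_card hS]
  simp

/-- In a simple polytope, two neighbours of a vertex lie with it in a common `k`-face. -/
theorem IsSimplePolytope.exists_isKFace_of_adj [FiniteDimensional ℝ E] {P : Set E} {d k : ℕ}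
    (hP : IsSimplePolytope P d) (hk : 2 ≤ k) (hkd : k ≤ d) {v u w : PolytopeVertex P}
    (hu : (polytopeGraph P).Adj v u) (hw : (polytopeGraph P).Adj v w) :
    ∃ F : Set E, IsKFace P F k ∧ u ∈ faceVertices P F ∧ w ∈ faceVertices P F := by
  classical
  have : Finite (PolytopeVertex P) := hP.isPolytope.finite_extremePoints
  have : Fintype ((polytopeGraph P).neighborSet v) := Fintype.ofFinite _
  have hcard : Fintype.card ((polytopeGraph P).neighborSet v) = d := by
    have h := hP.degree_eq v
    rw [Set.encard_eq_coe_toFinset_card, Set.toFinset_card] at h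
    exact_mod_cast h
  obtain ⟨S, hS, -, rfl⟩ := Finset.exists_subsuperset_card_eq
    (Finset.subset_univ {(⟨u, hu⟩ : (polytopeGraph P).neighborSet v), ⟨w, hw⟩})
    (Finset.card_le_two.trans hk) (by rwa [Finset.card_univ, hcard])
  obtain ⟨F, hF, -, hSF⟩ := hP.exists_isKFace v S
  exact ⟨F, hF, hSF ⟨u, hu⟩ (hS (by simp)), hSF ⟨w, hw⟩ (hS (by simp))⟩

end PolytopeGeometry

/-! ### Confluence and uniqueness of sinks -/

section Sinks

variable {V : Type*}

theorem IsAcyclicOrientation.wellFounded [Finite V] {G : SimpleGraph V} {O : Digraph V}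
    (hO : IsAcyclicOrientation G O) : WellFounded fun a b => O.Adj b a := by
  have : Std.Irrefl (Relation.TransGen O.Adj) := ⟨hO.acyclic⟩
  have hwf := Finite.wellFounded_of_trans_of_irrefl (Function.swap (Relation.TransGen O.Adj))
  exact Subrelation.wf (fun h => Relation.TransGen.single h) hwf

/-- From every vertex in `W` a sink induced on `W` can be reached along directed edges. -/
theorem exists_inducedSinks_reflTransGen {O : Digraph V} (hwf : WellFounded fun a b => O.Adj b a)
    {W : Set V} {v : V} (hv : v ∈ W) :
    ∃ s ∈ inducedSinks O W, Relation.ReflTransGen O.Adj v s := by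
  induction v using hwf.induction with
  | _ v ih =>
    by_cases h : ∀ w ∈ W, ¬ O.Adj v w
    · exact ⟨v, ⟨hv, h⟩, .refl⟩
    · push Not at h
      obtain ⟨w, hw, hvw⟩ := h
      obtain ⟨s, hs, hws⟩ := ih w hvw hw
      exact ⟨s, hs, .head hvw hws⟩

/-- If any two out-neighbours of a vertex lie in a set with at most one induced sink, then a
connected acyclically oriented graph has at most one global sink. -/
theorem IsAcyclicOrientation.subsingleton_inducedSinks_univ [Finite V] {G : SimpleGraph V}
    {O : Digraph V} (hO : IsAcyclicOrientation G O) (hG : G.Preconnected)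
    (h : ∀ v u w, O.Adj v u → O.Adj v w →
      ∃ W : Set V, u ∈ W ∧ w ∈ W ∧ (inducedSinks O W).Subsingleton) :
    (inducedSinks O Set.univ).Subsingleton := by
  have hwf := hO.wellFounded
  have huniq : ∀ x, ∀ s ∈ inducedSinks O Set.univ, ∀ t ∈ inducedSinks O Set.univ,
      Relation.ReflTransGen O.Adj x s → Relation.ReflTransGen O.Adj x t → s = t := by
    intro x
    induction x using hwf.induction with
    | _ x ih =>
      intro s hs t ht hxs hxt
      rcases hxs.cases_head with rfl | ⟨u, hxu, hus⟩
      · rcases hxt.cases_head with rfl | ⟨w, hxw, -⟩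
        · rfl
        · exact absurd hxw (hs.2 w trivial)
      · rcases hxt.cases_head with rfl | ⟨w, hxw, hwt⟩
        · exact absurd hxu (ht.2 u trivial)
        · obtain ⟨W, huW, hwW, hW⟩ := h x u w hxu hxw
          obtain ⟨f, hf, huf⟩ := exists_inducedSinks_reflTransGen hwf huW
          obtain ⟨g, hg, hwg⟩ := exists_inducedSinks_reflTransGen hwf hwW
          obtain rfl := hW hf hg
          -- The common face sink `f` need not be a global sink, but it reaches one, `r`. Induction
          -- at `u` and at `w` identifies both `s` and `t` with `r`.
          obtain ⟨r, hr, hfr⟩ := exists_inducedSinks_reflTransGen hwf (Set.mem_univ f)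
          exact (ih u hxu s hs r hr hus (huf.trans hfr)).trans
            (ih w hxw r hr t ht (hwg.trans hfr) hwt)
  -- Crossing an edge in either direction preserves the sink reached: a sink reached from the head
  -- is also reached from the tail, which reaches only one.
  have hstep : ∀ x y s, O.Adj x y → s ∈ inducedSinks O Set.univ →
      (Relation.ReflTransGen O.Adj x s ↔ Relation.ReflTransGen O.Adj y s) := by
    intro x y s hxy hs
    refine ⟨fun hxs => ?_, fun hys => .head hxy hys⟩
    obtain ⟨t, ht, hyt⟩ := exists_inducedSinks_reflTransGen hwf (Set.mem_univ y)
    rwa [huniq x s hs t ht hxs (.head hxy hyt)]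
  intro s hs t ht
  have hwalk : ∀ {x y : V}, G.Walk x y → Relation.ReflTransGen O.Adj x s →
      Relation.ReflTransGen O.Adj y s := by
    intro x y p
    induction p with
    | nil => exact id
    | cons hadj _ ih =>
      intro hx
      rcases (hO.adj_iff _ _).1 hadj with hxy | hyx
      · exact ih ((hstep _ _ s hxy hs).1 hx)
      · exact ih ((hstep _ _ s hyx hs).2 hx)
  obtain ⟨p⟩ := hG s t
  exact huniq t s hs t ht (hwalk p .refl) .refl

end Sinks

theorem mainTheorem3 {E : Type*} [NormedAddCommGroup E] [NormedSpace ℝ E] [FiniteDimensional ℝ E]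
    (P : Set E) (d k : ℕ) (hP : IsSimplePolytope P d) (hk : 2 ≤ k) (hkd : k ≤ d - 1)
    (O : Digraph (PolytopeVertex P)) (hO : IsAcyclicOrientation (polytopeGraph P) O)
    (hsinks : (inducedSinks O Set.univ).Nontrivial) :
    ∃ F : Set E, IsKFace P F k ∧ (inducedSinks O (faceVertices P F)).Nontrivial := by
  by_contra! hcon
  have : Finite (PolytopeVertex P) := hP.isPolytope.finite_extremePoints
  refine Set.not_subsingleton_iff.2 hsinks (hO.subsingleton_inducedSinks_univ
    hP.isPolytope.preconnected_polytopeGraph fun v u w hu hw => ?_)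
  obtain ⟨F, hF, huF, hwF⟩ := hP.exists_isKFace_of_adj hk (by omega)
    ((hO.adj_iff v u).2 (.inl hu)) ((hO.adj_iff v w).2 (.inl hw))
  exact ⟨_, huF, hwF, hcon F hF⟩
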